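/- Let $X$ and $Y$ be Polish spaces with their Borel $\sigma$-algebras $\mathcal B(X)$ and $\mathcal B(Y)$, let $\phi\colon X\to Y$ be Borel measurable, and let $\mu$ and $\nu$ be measures on $\mathcal B(X)$ and $\mathcal B(Y)$. Let $\{\mu_y : y\in Y\}$ be a $\sigma$-finite disintegration of $\mu$ with respect to $(\nu,\phi)$; that is, each $\mu_y$ is a $\sigma$-finite measure on $\mathcal B(X)$, and - for every $B\in\mathcal B(X)$ the map $y\mapsto\mu_y(B)$ is Borel measurable, - $\mu_y(X\setminus\phi^{-1}(y))=0$ for every $y\in Y$, - $\mu(B)=\int_Y\mu_y(B)\,d\nu(y)$ for every $B\in\mathcal B(X)$. Let $\mathcal K(X)$ be the space of compact subsets of $X$ with the Vietoris topology. Consider the following statements. 1. $\{\mu_y\}$ is uniformly $\sigma$-finite: there is a sequence $(B_n)$ in $\mathcal B(X)$ such that $\mu_y(B_n)<\infty$ for all $n$ and all $y\in Y$, and $\mu_y\left(X\setminus\bigcup_n B_n\right)=0$ for all $y\in Y$. 2. There is a sequence of Borel maps $y\mapsto K_n(y)$ from $Y$ into $\mathcal K(X)$ such that $\mu_y(K_n(y))<\infty$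 for all $y$ and $n$, and $\mu_y\left(X\setminus\bigcup_n K_n(y)\right)=0$ for all $y$. 3. The map $(y,K)\mapsto\mu_y(K)$ from $Y\times\mathcal K(X)$ to $[0,\infty]$ is Borel measurable. Then (1) and (2) are equivalent, and each of them implies (3). Moreover, if every $\mu_y$ is purely atomic (every Borel set of positive $\mu_y$-measure contains an atom of $\mu_y$, that is, a Borel set of positive $\mu_y$-measure that is not the union of two disjoint Borel sets of positive $\mu_y$-measure), then (1), (2) and (3) are equivalent. -/

import Mathlib

open MeasureTheory TopologicalSpace
open scoped ENNReal

/-- The space of compact subsets of `X` (the empty set included), with its Vietoris topology,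
carries the Borel σ-algebra of that topology. -/
instance compactsMeasurableSpace (X : Type*) [TopologicalSpace X] :
    MeasurableSpace (Compacts X) :=
  borel (Compacts X)

instance compactsBorelSpace (X : Type*) [TopologicalSpace X] : BorelSpace (Compacts X) :=
  ⟨rfl⟩

/-- The family `κ y` of measures on `X` is a disintegration of `μ` with respect to `(ν, φ)`. -/
structure IsDisintegration {X Y : Type*} [MeasurableSpace X] [MeasurableSpace Y]
    (κ : Y → Measure X) (μ : Measure X) (ν : Measure Y) (φ : X → Y) : Prop where
  measurable_apply : ∀ B : Set X, MeasurableSet B → Measurable fun y => κ y B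
  fiber : ∀ y : Y, κ y (φ ⁻¹' {y})ᶜ = 0
  apply_eq_lintegral : ∀ B : Set X, MeasurableSet B → μ B = ∫⁻ y, κ y B ∂ν

/-- A disintegration all of whose members are σ-finite measures. -/
structure IsSigmaFiniteDisintegration {X Y : Type*} [MeasurableSpace X] [MeasurableSpace Y]
    (κ : Y → Measure X) (μ : Measure X) (ν : Measure Y) (φ : X → Y) : Prop
    extends IsDisintegration κ μ ν φ where
  sigmaFinite : ∀ y : Y, SigmaFinite (κ y)

/-- A single sequence of measurable sets witnesses the σ-finiteness of all `κ y` at once. -/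
def UniformlySigmaFinite {X Y : Type*} [MeasurableSpace X] (κ : Y → Measure X) : Prop :=
  ∃ B : ℕ → Set X, (∀ n, MeasurableSet (B n)) ∧
    (∀ n y, κ y (B n) < ∞) ∧ ∀ y, κ y (⋃ n, B n)ᶜ = 0

/-- There are Borel maps `K n` from `Y` to the compact subsets of `X` such that, for every `y`,
the sets `K n y` have finite `κ y`-measure and together carry `κ y`. -/
def HasBorelCompactExhaustion {X Y : Type*} [TopologicalSpace X] [MeasurableSpace X]
    [MeasurableSpace Y] (κ : Y → Measure X) : Prop :=
  ∃ K : ℕ → Y → Compacts X, (∀ n, Measurable (K n)) ∧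
    (∀ y n, κ y (K n y : Set X) < ∞) ∧ ∀ y, κ y (⋃ n, (K n y : Set X))ᶜ = 0

/-- The map `(y, K) ↦ κ y K` from `Y × Compacts X` to `[0, ∞]` is Borel measurable. -/
def JointlyBorelOnCompacts {X Y : Type*} [TopologicalSpace X] [MeasurableSpace X]
    [TopologicalSpace Y] (κ : Y → Measure X) : Prop :=
  Measurable[borel (Y × Compacts X)] fun p : Y × Compacts X => κ p.1 (p.2 : Set X)

/-- `A` is an atom of `m`: it has positive measure, and it cannot be split into two measurable
parts of positive measure. -/
def IsMeasureAtom {X : Type*} [MeasurableSpace X] (m : Measure X) (A : Set X) : Prop :=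
  MeasurableSet A ∧ 0 < m A ∧ ∀ B ⊆ A, MeasurableSet B → m B = 0 ∨ m (A \ B) = 0

/-- Every measurable set of positive measure contains an atom. The zero measure qualifies. -/
def IsPurelyAtomicMeasure {X : Type*} [MeasurableSpace X] (m : Measure X) : Prop :=
  ∀ E : Set X, MeasurableSet E → 0 < m E → ∃ A ⊆ E, IsMeasureAtom m A

open Filter Set Topology Uniformity

/-!
For finite measures, a Borel compact exhaustion comes from the usual proof of tightness: in a
complete space with a dense sequence `x`, the sets `⋂ n, ⋃ m ≤ s n, {z | (z, x m) ∈ V n}` are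
compact and depend upper hemicontinuously, hence Borel measurably, on `s : ℕ → ℕ`, while the least
admissible bounds `s n` are Borel functions of the measure. A uniformly σ-finite family is treated
on each `B n` separately, after refining the topology so that `B n` is Polish. Conversely, since
`κ y` lives on the fibre over `y`, the sets `{x | x ∈ K n (φ x)}` witness uniform σ-finiteness.

If all `κ y` are purely atomic, `κ y` is carried by the set `{x | 0 < κ (φ x) {x}}`, which is Borel
by joint measurability on singletons and meets each fibre in a countable set. By the
Lusin–Novikov theorem it is a countable union of Borel sets on which `φ` is injective, and these
have finite measure because each meets a fibre in at most one point.

The Lusin–Novikov theorem is proved by contradiction. Call a finite family of sets large if no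
σ-injective set can be removed so as to leave no fibre meeting all its members. Lusin separation
shows that outside any σ-injective set some fibre has two points in each member of a large family,
so that large families split; iterating yields a Cantor scheme, all branches of which end in one
fibre by continuity.
-/

section Hyperspace

variable {X Y : Type*} [TopologicalSpace X] [MeasurableSpace Y] {f : Y → Compacts X}

theorem measurableSet_setOf_compacts_inter_nonempty [PseudoMetrizableSpace X]
    (hf : ∀ U : Set X, IsOpen U → MeasurableSet {y | (f y : Set X) ⊆ U}) {U : Set X}
    (hU : IsOpen U) : MeasurableSet {y | ((f y : Set X) ∩ U).Nonempty} := by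
  let := pseudoMetrizableSpacePseudoMetric X
  obtain ⟨F, hF, -, rfl, -⟩ := hU.exists_iUnion_isClosed
  have hit_iff : {y | ((f y : Set X) ∩ ⋃ n, F n).Nonempty} =
      ⋃ n, {y | (f y : Set X) ⊆ (F n)ᶜ}ᶜ := by
    ext y
    simp [inter_iUnion, nonempty_iUnion, subset_compl_iff_disjoint_right,
      not_disjoint_iff_nonempty_inter]
  rw [hit_iff]
  exact .iUnion fun n => (hf _ (hF n).isOpen_compl).compl

theorem measurable_compacts_of_measurableSet_subset [PseudoMetrizableSpace X]
    [SecondCountableTopology X]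
    (hf : ∀ U : Set X, IsOpen U → MeasurableSet {y | (f y : Set X) ⊆ U}) : Measurable f := by
  have hb := isBasis_countableBasis X
  rw [BorelSpace.measurable_eq (α := Compacts X), hb.compacts.borel_eq_generateFrom]
  refine measurable_generateFrom ?_
  rintro _ ⟨u, ⟨hu, hub⟩, rfl⟩
  have preimage_eq : f ⁻¹' {K : Compacts X | ↑K ⊆ ⋃₀ u ∧ ∀ U ∈ u, (↑K ∩ U).Nonempty} =
      {y | (f y : Set X) ⊆ ⋃₀ u} ∩ ⋂ U ∈ u, {y | ((f y : Set X) ∩ U).Nonempty} := by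
    ext y
    simp
  rw [preimage_eq]
  exact (hf _ (isOpen_sUnion fun U hU => hb.isOpen (hub hU))).inter (.biInter hu.countable
    fun U hU => measurableSet_setOf_compacts_inter_nonempty hf (hb.isOpen (hub hU)))

theorem isClosed_setOf_mem_compacts (X : Type*) [TopologicalSpace X] [T2Space X] :
    IsClosed {p : X × Compacts X | p.1 ∈ p.2} := by
  have h := (Compacts.isOpen_setOfPred_disjoint_coe (α := X)).isClosed_compl.preimage
    ((Compacts.continuous_singleton (α := X)).prodMap continuous_id)
  convert h using 1
  ext ⟨x, K⟩
  simp

end Hyperspace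

section CompactInterUnionBalls

variable {X : Type*} [UniformSpace X] {V : ℕ → SetRel X X}

theorem isClosed_biUnion_ball (hV : ∀ n, IsClosed (V n)) (x : ℕ → X) (n k : ℕ) :
    IsClosed (⋃ m ≤ k, UniformSpace.ball (x m) (Prod.swap ⁻¹' V n)) :=
  (finite_le_nat k).isClosed_biUnion fun _ _ =>
    (hV n).preimage (continuous_id.prodMk continuous_const)

variable [CompleteSpace X]

/-- For a dense sequence `x` and a uniformity basis of closed entourages `V n`, these compact sets
exhaust every finite measure, while depending upper hemicontinuously on the bounds `s`. -/
def compactInterUnionBalls (hVc : ∀ n, IsClosed (V n))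
    (hV : (𝓤 X).HasBasis (fun _ => True) V) (x : ℕ → X) (s : ℕ → ℕ) : Compacts X where
  carrier := interUnionBalls x s V
  isCompact' := by
    have hclosed : IsClosed (interUnionBalls x s V) :=
      isClosed_iInter fun n => isClosed_biUnion_ball hVc x n (s n)
    exact hclosed.closure_eq ▸ isCompact_closure_interUnionBalls hV x s

theorem upperHemicontinuous_compactInterUnionBalls (hVc : ∀ n, IsClosed (V n))
    (hV : (𝓤 X).HasBasis (fun _ => True) V) (x : ℕ → X) :
    UpperHemicontinuous fun s => (compactInterUnionBalls hVc hV x s : Set X) := by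
  have := hV.isCountablyGenerated
  refine upperHemicontinuous_iff.2 fun s => .of_frequently fun F hF hs => ?_
  obtain ⟨t, hts, ht⟩ := exists_seq_forall_of_frequently hs
  choose z hz hzF using ht
  have eventually_eq : ∀ n, ∀ᶠ k in atTop, t k n = s n := fun n =>
    (tendsto_pi_nhds.1 hts n).eventually_mem ((isOpen_discrete {s n}).mem_nhds rfl)
  choose b hb using fun n => (tendsto_pi_nhds.1 hts n).bddAbove_range
  have hzb : ∀ k, z k ∈ interUnionBalls x b V := fun k => mem_iInter.2 fun n =>
    biUnion_subset_biUnion_left (fun m hm => le_trans hm (hb n (mem_range_self k)))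
      (mem_iInter.1 (hz k) n)
  obtain ⟨w, -, e, he, hew⟩ := (compactInterUnionBalls hVc hV x b).isCompact.tendsto_subseq hzb
  refine ⟨w, mem_iInter.2 fun n => ?_, hF.mem_of_tendsto hew (.of_forall fun _ => hzF _)⟩
  refine (isClosed_biUnion_ball hVc x n (s n)).mem_of_tendsto hew ?_
  filter_upwards [he.tendsto_atTop.eventually (eventually_eq n)] with k hk
  exact hk ▸ mem_iInter.1 (hz (e k)) n

theorem measurable_compactInterUnionBalls [SecondCountableTopology X]
    (hVc : ∀ n, IsClosed (V n)) (hV : (𝓤 X).HasBasis (fun _ => True) V) (x : ℕ → X) :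
    Measurable (compactInterUnionBalls hVc hV x) := by
  have := hV.isCountablyGenerated
  exact measurable_compacts_of_measurableSet_subset fun U hU =>
    (upperHemicontinuous_iff_isOpen_preimage_Iic.1
      (upperHemicontinuous_compactInterUnionBalls hVc hV x) U hU).measurableSet

end CompactInterUnionBalls

section MeasurableTightness

variable {X Y : Type*} [MeasurableSpace X] [MeasurableSpace Y] {κ : Y → Measure X}

theorem exists_measurable_measure_compl_biUnion_le_lt (hκ : Measurable κ)
    [∀ y, IsFiniteMeasure (κ y)] {f : ℕ → Set X} (hf : ∀ n, MeasurableSet (f n))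
    (hcover : ⋃ n, f n = univ) {ε : ℝ≥0∞} (hε : 0 < ε) :
    ∃ s : Y → ℕ, Measurable s ∧ ∀ y, κ y (⋃ m ≤ s y, f m)ᶜ < ε := by
  classical
  have exists_bound : ∀ y, ∃ k, κ y (⋃ m ≤ k, f m)ᶜ < ε := fun y => by
    simp_rw [compl_iUnion]
    exact exists_measure_iInter_lt (fun n => (hf n).compl.nullMeasurableSet) hε
      ⟨0, measure_ne_top _ _⟩ (by rw [← compl_iUnion, hcover, compl_univ])
  refine ⟨fun y => Nat.find (exists_bound y), measurable_find exists_bound fun k => ?_,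
    fun y => Nat.find_spec (exists_bound y)⟩
  have hk : MeasurableSet (⋃ m ≤ k, f m)ᶜ := (MeasurableSet.biUnion (to_countable _)
    fun m _ => hf m).compl
  exact measurableSet_lt (Measure.measurable_measure.1 hκ _ hk) measurable_const

variable [TopologicalSpace X] [BorelSpace X]

theorem exists_measurable_compacts_measure_compl_lt [PolishSpace X] (hκ : Measurable κ)
    [∀ y, IsFiniteMeasure (κ y)] {ε : ℝ≥0∞} (hε : ε ≠ 0) :
    ∃ K : Y → Compacts X, Measurable K ∧ ∀ y, κ y (K y : Set X)ᶜ < ε := by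
  let := upgradeIsCompletelyMetrizable X
  rcases isEmpty_or_nonempty X with _ | _
  · exact ⟨fun _ => ⊥, measurable_const, fun y => by
      simpa [eq_empty_of_isEmpty] using pos_iff_ne_zero.2 hε⟩
  obtain ⟨V, hV, hVbasis⟩ := (uniformity_hasBasis_closed (α := X)).exists_antitone_subbasis
  have hVc : ∀ n, IsClosed (V n) := fun n => (hV n).2
  obtain ⟨δ, hδpos, hδ⟩ := ENNReal.exists_pos_sum_of_countable' hε ℕ
  have exists_bound : ∀ n, ∃ s : Y → ℕ, Measurable s ∧ ∀ y,
      κ y (⋃ m ≤ s y, UniformSpace.ball (denseSeq X m) (Prod.swap ⁻¹' V n))ᶜ < δ n := fun n =>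
    exists_measurable_measure_compl_biUnion_le_lt hκ
      (fun m => ((hVc n).preimage (continuous_id.prodMk continuous_const)).measurableSet)
      ((denseRange_denseSeq X).iUnion_uniformity_ball (symm_le_uniformity (hV n).1)) (hδpos n)
  choose s hs hsδ using exists_bound
  refine ⟨fun y => compactInterUnionBalls hVc hVbasis.toHasBasis (denseSeq X) fun n => s n y,
    (measurable_compactInterUnionBalls hVc _ _).comp (measurable_pi_lambda _ hs), fun y => ?_⟩
  calc κ y (interUnionBalls (denseSeq X) (fun n => s n y) V)ᶜ
      ≤ ∑' n, κ y (⋃ m ≤ s n y, UniformSpace.ball (denseSeq X m) (Prod.swap ⁻¹' V n))ᶜ := by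
        rw [interUnionBalls, compl_iInter]
        exact measure_iUnion_le _
    _ ≤ ∑' n, δ n := ENNReal.tsum_le_tsum fun n => (hsδ n y).le
    _ < ε := hδ

theorem hasBorelCompactExhaustion_of_isFiniteMeasure [PolishSpace X] (hκ : Measurable κ)
    [∀ y, IsFiniteMeasure (κ y)] : HasBorelCompactExhaustion κ := by
  choose K hK hKlt using fun n : ℕ => exists_measurable_compacts_measure_compl_lt hκ
    (ENNReal.inv_ne_zero.2 (ENNReal.natCast_ne_top n))
  refine ⟨K, hK, fun y n => measure_lt_top _ _, fun y => le_antisymm ?_ zero_le⟩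
  refine ge_of_tendsto' ENNReal.tendsto_inv_nat_nhds_zero fun n => ?_
  exact (measure_mono (compl_subset_compl.2 (subset_iUnion (fun n => (K n y : Set X)) n))).trans
    (hKlt n y).le

end MeasurableTightness

theorem exists_polishSpace_borelSpace_continuous {Z Y : Type*} [MeasurableSpace Z]
    [StandardBorelSpace Z] [TopologicalSpace Y] [SecondCountableTopology Y] [MeasurableSpace Y]
    [OpensMeasurableSpace Y] {f : Z → Y} (hf : Measurable f) :
    ∃ _ : TopologicalSpace Z, PolishSpace Z ∧ BorelSpace Z ∧ Continuous f := by
  obtain ⟨τ, hτborel, hτ⟩ := StandardBorelSpace.polish (α := Z)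
  have hZ := BorelSpace.measurable_eq (α := Z)
  obtain ⟨τ', hle, hcont, hτ'⟩ := hf.exists_continuous
  exact ⟨τ', hτ', ⟨hZ.trans (borel_eq_borel_of_le hτ' hτ hle).symm⟩, hcont⟩

section Exhaustion

variable {X Y : Type*} [TopologicalSpace X] [SecondCountableTopology X] [MeasurableSpace X]
  [BorelSpace X] [StandardBorelSpace X] [MeasurableSpace Y] {κ : Y → Measure X}

theorem exists_measurable_compacts_subset (hκ : Measurable κ) {B : Set X} (hB : MeasurableSet B)
    (hfin : ∀ y, κ y B < ∞) :
    ∃ K : ℕ → Y → Compacts X, (∀ k, Measurable (K k)) ∧ (∀ k y, (K k y : Set X) ⊆ B) ∧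
      ∀ y, κ y (B \ ⋃ k, (K k y : Set X)) = 0 := by
  have : StandardBorelSpace B := hB.standardBorel
  have hi : MeasurableEmbedding (Subtype.val : B → X) := .subtype_coe hB
  obtain ⟨_, _, _, hcont⟩ := exists_polishSpace_borelSpace_continuous hi.measurable
  have : ∀ y, IsFiniteMeasure ((κ y).comap (Subtype.val : B → X)) := fun y =>
    ⟨by simpa [hi.comap_apply] using hfin y⟩
  obtain ⟨K, hK, -, hKnull⟩ := hasBorelCompactExhaustion_of_isFiniteMeasure
    (κ := fun y => (κ y).comap (Subtype.val : B → X))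
    (Measure.measurable_measure.2 fun s hs => by
      simpa only [hi.comap_apply] using
        Measure.measurable_measure.1 hκ _ (hi.measurableSet_image.2 hs))
  refine ⟨fun k y => (K k y).map Subtype.val hcont,
    fun k => hcont.compacts_map.measurable.comp (hK k),
    fun k y => Subtype.coe_image_subset _ _, fun y => ?_⟩
  simpa only [hi.comap_apply, image_compl_eq_range_sdiff_image hi.injective, image_iUnion,
    Subtype.range_coe, Compacts.coe_map] using hKnull y

theorem UniformlySigmaFinite.hasBorelCompactExhaustion (hκ : Measurable κ)
    (h : UniformlySigmaFinite κ) : HasBorelCompactExhaustion κ := by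
  obtain ⟨B, hB, hfin, hnull⟩ := h
  choose K hK hKB hKnull using fun n => exists_measurable_compacts_subset hκ (hB n) (hfin n)
  refine ⟨fun n => K n.unpair.1 n.unpair.2, fun n => hK _ _,
    fun y n => (measure_mono (hKB _ _ y)).trans_lt (hfin _ y), fun y => ?_⟩
  refine measure_mono_null ?_
    (measure_union_null (hnull y) (measure_iUnion_null fun n => hKnull n y))
  rw [iUnion_unpair fun n k => (K n k y : Set X)]
  intro x hx
  by_cases hxB : x ∈ ⋃ n, B n
  · obtain ⟨n, hn⟩ := mem_iUnion.1 hxB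
    exact .inr (mem_iUnion.2 ⟨n, hn, fun hxK => hx (mem_iUnion_of_mem n hxK)⟩)
  · exact .inl hxB

end Exhaustion

section SigmaInjective

variable {Z Y : Type*} [MeasurableSpace Z] {φ : Z → Y}

/-- `N` is a countable union of measurable sets on each of which `φ` is injective. These sets form
the σ-ideal that is negligible in the proof of the Lusin–Novikov theorem. -/
def IsSigmaInjOn (φ : Z → Y) (N : Set Z) : Prop :=
  ∃ B : ℕ → Set Z, (∀ n, MeasurableSet (B n)) ∧ (∀ n, InjOn φ (B n)) ∧ ⋃ n, B n = N

theorem IsSigmaInjOn.measurableSet {N : Set Z} (h : IsSigmaInjOn φ N) : MeasurableSet N := by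
  obtain ⟨B, hB, -, rfl⟩ := h
  exact .iUnion hB

theorem IsSigmaInjOn.of_injOn {N : Set Z} (hN : MeasurableSet N) (h : InjOn φ N) :
    IsSigmaInjOn φ N :=
  ⟨fun _ => N, fun _ => hN, fun _ => h, iUnion_const N⟩

theorem IsSigmaInjOn.iUnion {ι : Type*} [Countable ι] {N : ι → Set Z}
    (h : ∀ i, IsSigmaInjOn φ (N i)) : IsSigmaInjOn φ (⋃ i, N i) := by
  rcases isEmpty_or_nonempty ι with _ | _
  · rw [iUnion_of_empty]
    exact .of_injOn .empty (injOn_empty φ)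
  choose B hB hinj hunion using h
  obtain ⟨e, he⟩ := exists_surjective_nat ι
  refine ⟨fun n => B (e n.unpair.1) n.unpair.2, fun n => hB _ _, fun n => hinj _ _, ?_⟩
  rw [iUnion_unpair fun n k => B (e n) k, he.iUnion_comp fun i => ⋃ k, B i k]
  exact iUnion_congr hunion

theorem IsSigmaInjOn.union {N M : Set Z} (hN : IsSigmaInjOn φ N) (hM : IsSigmaInjOn φ M) :
    IsSigmaInjOn φ (N ∪ M) := by
  rw [union_eq_iUnion]
  exact .iUnion (Bool.forall_bool.2 ⟨hM, hN⟩)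

end SigmaInjective

section AnalyticSeparation

theorem analyticSet_inter {Y : Type*} [TopologicalSpace Y] [T2Space Y] {S T : Set Y}
    (hS : AnalyticSet S) (hT : AnalyticSet T) : AnalyticSet (S ∩ T) := by
  rw [inter_eq_iInter]
  exact .iInter (Bool.forall_bool.2 ⟨hT, hS⟩)

variable {Y : Type*} [TopologicalSpace Y] [PolishSpace Y] [MeasurableSpace Y] [BorelSpace Y]

theorem exists_measurableSet_superset_iInter_eq_empty {ι : Type*} [Finite ι] {D : ι → Set Y}
    (hD : ∀ i, AnalyticSet (D i)) (hempty : ⋂ i, D i = ∅) :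
    ∃ E : ι → Set Y, (∀ i, MeasurableSet (E i)) ∧ (∀ i, D i ⊆ E i) ∧ ⋂ i, E i = ∅ := by
  classical
  have := Fintype.ofFinite ι
  suffices separate : ∀ (s : Finset ι) (T : Set Y), AnalyticSet T → T ∩ ⋂ i ∈ s, D i = ∅ →
      ∃ E : ι → Set Y, (∀ i, MeasurableSet (E i)) ∧ (∀ i, D i ⊆ E i) ∧
        T ∩ ⋂ i ∈ s, E i = ∅ by
    simpa [hempty] using separate Finset.univ univ isClosed_univ.analyticSet
  intro s
  induction s using Finset.induction_on with
  | empty => exact fun T _ hT => ⟨fun _ => univ, fun _ => .univ, fun _ => subset_univ _, by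
      simpa using hT⟩
  | insert a s _ ih =>
    intro T hT hTD
    rw [Finset.set_biInter_insert, ← inter_assoc] at hTD
    obtain ⟨E, hE, hDE, hTDE⟩ := ih (T ∩ D a) (analyticSet_inter hT (hD a)) hTD
    have hEs : AnalyticSet (⋂ i ∈ s, E i) :=
      (Finset.measurableSet_biInter s fun i _ => hE i).analyticSet
    have hdisj : Disjoint (D a) (T ∩ ⋂ i ∈ s, E i) := by
      rw [disjoint_iff_inter_eq_empty, ← hTDE]
      ac_rfl
    obtain ⟨F, hDF, hF, hFm⟩ := (hD a).measurablySeparable (analyticSet_inter hT hEs) hdisj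
    refine ⟨fun i => if i = a then E a ∩ F else E i, fun i => ?_, fun i => ?_, ?_⟩
    · dsimp only
      split_ifs
      exacts [(hE a).inter hFm, hE i]
    · dsimp only
      split_ifs with h
      exacts [h.symm ▸ subset_inter (hDE a) hDF, hDE i]
    · refine eq_empty_of_forall_notMem fun y ⟨hyT, hy⟩ => ?_
      simp only [mem_iInter] at hy
      have hya : y ∈ E a ∩ F := by simpa using hy a (Finset.mem_insert_self a s)
      refine disjoint_left.1 hF ⟨hyT, mem_iInter₂.2 fun i hi => ?_⟩ hya.2
      have hyi := hy i (Finset.mem_insert_of_mem hi)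
      split_ifs at hyi with h
      exacts [h ▸ hya.1, hyi]

theorem analyticSet_setOf_nontrivial_inter_fiber {Z : Type*} [MeasurableSpace Z]
    [StandardBorelSpace Z] {φ : Z → Y} (hφ : Measurable φ) {A : Set Z} (hA : MeasurableSet A) :
    AnalyticSet {y | (A ∩ φ ⁻¹' {y}).Nontrivial} := by
  have hpairs : MeasurableSet ((A ×ˢ A ∩ {p : Z × Z | φ p.1 = φ p.2}) \ diagonal Z) :=
    ((hA.prod hA).inter (measurableSet_eq_fun (hφ.comp measurable_fst)
      (hφ.comp measurable_snd))).diff measurableSet_diagonal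
  convert hpairs.analyticSet_image (hφ.comp measurable_fst) using 1
  ext y
  constructor
  · rintro ⟨z, ⟨hz, rfl⟩, w, ⟨hw, hwz⟩, hne⟩
    exact ⟨(z, w), ⟨⟨⟨hz, hw⟩, hwz.symm⟩, hne⟩, rfl⟩
  · rintro ⟨⟨z, w⟩, ⟨⟨⟨hz, hw⟩, hzw⟩, hne⟩, rfl⟩
    exact ⟨z, ⟨hz, rfl⟩, w, ⟨hw, hzw.symm⟩, hne⟩

end AnalyticSeparation

section LargeFamily

variable {Z Y ι : Type*} [MeasurableSpace Z] {φ : Z → Y} {A : ι → Set Z}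

/-- No σ-injective set can be removed so as to leave no fibre of `φ` meeting all the `A i`. Large
families are the nodes at each level of the Cantor scheme in the proof of the Lusin–Novikov
theorem. -/
def IsLargeFamily (φ : Z → Y) (A : ι → Set Z) : Prop :=
  ∀ N, IsSigmaInjOn φ N → (⋂ i, φ '' (A i \ N)).Nonempty

theorem IsLargeFamily.comp {ι' : Type*} (h : IsLargeFamily φ A) (e : ι' → ι) :
    IsLargeFamily φ (A ∘ e) := fun N hN =>
  (h N hN).mono (subset_iInter fun i => iInter_subset _ (e i))

theorem isLargeFamily_univ_of_not_isSigmaInjOn (h : ¬ IsSigmaInjOn φ univ) :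
    IsLargeFamily φ fun _ : ι => univ := fun N hN => by
  obtain ⟨z, hz⟩ : Nᶜ.Nonempty := nonempty_compl.2 fun hN' => h (hN' ▸ hN)
  exact ⟨φ z, mem_iInter.2 fun _ => ⟨z, ⟨mem_univ z, hz⟩, rfl⟩⟩

variable [StandardBorelSpace Z] [TopologicalSpace Y] [PolishSpace Y] [MeasurableSpace Y]
  [BorelSpace Y] [Finite ι]

theorem IsLargeFamily.exists_forall_nontrivial (h : IsLargeFamily φ A) (hφ : Measurable φ)
    (hA : ∀ i, MeasurableSet (A i)) {N : Set Z} (hN : IsSigmaInjOn φ N) :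
    ∃ y, ∀ i, ((A i \ N) ∩ φ ⁻¹' {y}).Nontrivial := by
  by_contra! hsub
  have hAN : ∀ i, MeasurableSet (A i \ N) := fun i => (hA i).diff hN.measurableSet
  obtain ⟨E, hE, hDE, hempty⟩ := exists_measurableSet_superset_iInter_eq_empty
    (D := fun i => {y | ((A i \ N) ∩ φ ⁻¹' {y}).Nontrivial})
    (fun i => analyticSet_setOf_nontrivial_inter_fiber hφ (hAN i))
    (eq_empty_of_forall_notMem fun y hy => by
      obtain ⟨i, hi⟩ := hsub y
      exact not_nontrivial_iff.2 hi (mem_iInter.1 hy i))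
  have hR : ∀ i, IsSigmaInjOn φ ((A i \ N) \ φ ⁻¹' E i) := fun i =>
    .of_injOn ((hAN i).diff (hφ (hE i))) fun z hz w hw hzw => by
      by_contra hne
      exact hz.2 (hDE i ⟨z, ⟨hz.1, rfl⟩, w, ⟨hw.1, hzw.symm⟩, hne⟩)
  obtain ⟨y, hy⟩ := h (N ∪ ⋃ i, (A i \ N) \ φ ⁻¹' E i) (hN.union (.iUnion hR))
  refine eq_empty_iff_forall_notMem.1 hempty y (mem_iInter.2 fun i => ?_)
  obtain ⟨z, ⟨hzA, hzN⟩, rfl⟩ := mem_iInter.1 hy i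
  by_contra hzE
  exact hzN (.inr (mem_iUnion.2 ⟨i, ⟨hzA, fun hz => hzN (.inl hz)⟩, hzE⟩))

theorem IsLargeFamily.exists_split (h : IsLargeFamily φ A) (hφ : Measurable φ)
    (hA : ∀ i, MeasurableSet (A i)) {P : Set (Bool → Set Z)} (hP : P.Countable)
    (hsep : ∀ x x', x ≠ x' → ∃ p ∈ P, x ∈ p true ∧ x' ∈ p false) :
    ∃ k : ι → P, IsLargeFamily φ fun q : ι × Bool => A q.1 ∩ (k q.1).1 q.2 := by
  by_contra! hsmall
  simp only [IsLargeFamily, not_forall, not_nonempty_iff_eq_empty] at hsmall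
  choose N hN hempty using hsmall
  have := hP.to_subtype
  -- A fibre with two points of each `A i` outside every `N k` defeats the choice `k` of pairs
  -- separating those points.
  obtain ⟨y, hy⟩ := h.exists_forall_nontrivial hφ hA (.iUnion hN)
  choose x hx x' hx' hne using hy
  choose p hpP hp using fun i => hsep _ _ (hne i)
  refine eq_empty_iff_forall_notMem.1 (hempty fun i => ⟨p i, hpP i⟩) y
    (mem_iInter.2 fun ⟨i, b⟩ => ?_)
  cases b
  · exact ⟨x' i, ⟨⟨(hx' i).1.1, (hp i).2⟩, fun hN' => (hx' i).1.2 (mem_iUnion_of_mem _ hN')⟩,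
      (hx' i).2⟩
  · exact ⟨x i, ⟨⟨(hx i).1.1, (hp i).1⟩, fun hN' => (hx i).1.2 (mem_iUnion_of_mem _ hN')⟩,
      (hx i).2⟩

end LargeFamily

section CantorScheme

theorem exists_countable_separating_closed_pairs (Z : Type*) [EMetricSpace Z]
    [SecondCountableTopology Z] {ε : ℝ≥0∞} (hε : 0 < ε) :
    ∃ P : Set (Bool → Set Z), P.Countable ∧
      (∀ p ∈ P, (∀ b, IsClosed (p b) ∧ Metric.ediam (p b) ≤ ε) ∧ Disjoint (p false) (p true)) ∧
      ∀ x x', x ≠ x' → ∃ p ∈ P, x ∈ p true ∧ x' ∈ p false := by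
  have hb := isBasis_countableBasis Z
  let C : Set (Set Z) := closure '' {U ∈ countableBasis Z | Metric.ediam U ≤ ε}
  have hC : C.Countable := ((countable_countableBasis Z).mono (sep_subset _ _)).image _
  refine ⟨{p | ∀ b, p b ∈ C} ∩ {p | Disjoint (p false) (p true)},
    (countable_pi fun _ => hC).mono inter_subset_left, fun p hp => ⟨fun b => ?_, hp.2⟩,
    fun x x' hne => ?_⟩
  · obtain ⟨U, hU, hpU⟩ := hp.1 b
    exact ⟨hpU ▸ isClosed_closure, by rw [← hpU, Metric.ediam_closure]; exact hU.2⟩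
  · obtain ⟨u, hxu, hu, v, hxv, hv, huv⟩ := exists_open_nhds_disjoint_closure hne
    have exists_small : ∀ {z : Z} {w : Set Z}, IsOpen w → z ∈ w →
        ∃ U ∈ countableBasis Z, Metric.ediam U ≤ ε ∧ z ∈ U ∧ U ⊆ w := fun {z w} hw hz => by
      obtain ⟨U, hU, hzU, hUw⟩ := hb.exists_subset_of_mem_open
        (show z ∈ w ∩ Metric.eball z (ε / 2) from
          ⟨hz, Metric.mem_eball_self (ENNReal.half_pos hε.ne')⟩) (hw.inter Metric.isOpen_eball)
      refine ⟨U, hU, (Metric.ediam_mono (hUw.trans inter_subset_right)).trans ?_, hzU,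
        hUw.trans inter_subset_left⟩
      exact Metric.ediam_eball_le.trans_eq (ENNReal.mul_div_cancel two_ne_zero ENNReal.ofNat_ne_top)
    obtain ⟨U, hU, hUε, hxU, hUu⟩ := exists_small hu hxu
    obtain ⟨V, hV, hVε, hxV, hVv⟩ := exists_small hv hxv
    refine ⟨fun b => bif b then closure U else closure V, ⟨Bool.forall_bool.2
      ⟨⟨V, ⟨hV, hVε⟩, rfl⟩, ⟨U, ⟨hU, hUε⟩, rfl⟩⟩, ?_⟩, subset_closure hxU, subset_closure hxV⟩
    exact (huv.mono (closure_mono hUu) (closure_mono hVv)).symm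

theorem exists_injective_forall_map_eq {β Z Y : Type*} [MetricSpace Z] [CompleteSpace Z]
    [TopologicalSpace Y] [T2Space Y] {φ : Z → Y} (hφ : Continuous φ) {S : List β → Set Z}
    (hclosed : ∀ l, IsClosed (S l)) (hanti : CantorScheme.Antitone S)
    (hdisj : CantorScheme.Disjoint S) (hdiam : CantorScheme.VanishingDiam S)
    (hmeet : ∀ l l', l.length = l'.length → (φ '' S l ∩ φ '' S l').Nonempty) :
    ∃ f : (ℕ → β) → Z, Function.Injective f ∧ ∀ x x', φ (f x) = φ (f x') := by
  have hdom := (hanti.closureAntitone hclosed).map_of_vanishingDiam hdiam fun l =>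
    ((hmeet l l rfl).mono inter_subset_left).of_image
  let f : (ℕ → β) → Z := fun x => (CantorScheme.inducedMap S).2 ⟨x, hdom ▸ mem_univ x⟩
  have tendsto_f : ∀ x (z : ℕ → Z), (∀ n, z n ∈ S (PiNat.res x n)) → Tendsto z atTop (𝓝 (f x)) :=
    fun x z hz => tendsto_iff_edist_tendsto_0.2 <|
      tendsto_of_tendsto_of_tendsto_of_le_of_le tendsto_const_nhds (hdiam x) (fun _ => zero_le)
        fun n => Metric.edist_le_ediam_of_mem (hz n) (CantorScheme.map_mem _ n)
  refine ⟨f, fun x x' h => congrArg Subtype.val (hdisj.map_injective h), fun x x' => ?_⟩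
  have hmeet_res := fun n => hmeet (PiNat.res x n) (PiNat.res x' n)
    ((PiNat.res_length x n).trans (PiNat.res_length x' n).symm)
  choose y hy hy' using hmeet_res
  choose z hz hzy using hy
  choose z' hz' hzy' using hy'
  refine tendsto_nhds_unique ((hφ.tendsto _).comp (tendsto_f x z hz)) ?_
  refine ((hφ.tendsto _).comp (tendsto_f x' z' hz')).congr fun n => ?_
  exact (hzy' n).trans (hzy n).symm

end CantorScheme

section LusinNovikov

open scoped List.Vector

variable {Z Y : Type*} [MeasurableSpace Z] [TopologicalSpace Y] [PolishSpace Y]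
  [MeasurableSpace Y] [BorelSpace Y] {φ : Z → Y}

theorem IsLargeFamily.exists_refinement [MetricSpace Z] [SecondCountableTopology Z] [BorelSpace Z]
    [StandardBorelSpace Z] (hφ : Measurable φ) {n : ℕ} {A : List.Vector Bool n → Set Z}
    (h : IsLargeFamily φ A) (hA : ∀ v, IsClosed (A v)) {ε : ℝ≥0∞} (hε : 0 < ε) :
    ∃ A' : List.Vector Bool (n + 1) → Set Z, (∀ v, IsClosed (A' v)) ∧ IsLargeFamily φ A' ∧
      (∀ b v, A' (b ::ᵥ v) ⊆ A v) ∧ (∀ v, Metric.ediam (A' v) ≤ ε) ∧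
      ∀ v, Disjoint (A' (false ::ᵥ v)) (A' (true ::ᵥ v)) := by
  obtain ⟨P, hPc, hP, hsep⟩ := exists_countable_separating_closed_pairs Z hε
  obtain ⟨k, hk⟩ := h.exists_split hφ (fun v => (hA v).measurableSet) hPc hsep
  refine ⟨fun v => A v.tail ∩ (k v.tail).1 v.head, ?_, ?_, ?_, ?_, ?_⟩
  · exact fun v => (hA _).inter ((hP _ (k v.tail).2).1 v.head).1
  · exact hk.comp fun v : List.Vector Bool (n + 1) => (v.tail, v.head)
  · intro b v
    exact inter_subset_left
  · exact fun v => (Metric.ediam_mono inter_subset_right).trans ((hP _ (k v.tail).2).1 v.head).2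
  · intro v
    exact (hP _ (k v).2).2.mono inter_subset_right inter_subset_right

theorem exists_cantorScheme_isLargeFamily [MetricSpace Z] [SecondCountableTopology Z]
    [BorelSpace Z] [StandardBorelSpace Z] (hφ : Measurable φ) (h : ¬ IsSigmaInjOn φ univ) :
    ∃ S : List Bool → Set Z, (∀ l, IsClosed (S l)) ∧ CantorScheme.Antitone S ∧
      CantorScheme.Disjoint S ∧ CantorScheme.VanishingDiam S ∧
      ∀ n, IsLargeFamily φ fun v : List.Vector Bool n => S v.1 := by
  have hε : ∀ n : ℕ, 0 < ((n : ℝ≥0∞))⁻¹ := fun n => ENNReal.inv_pos.2 (ENNReal.natCast_ne_top n)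
  let Level (n : ℕ) := {A : List.Vector Bool n → Set Z // (∀ v, IsClosed (A v)) ∧
    IsLargeFamily φ A}
  choose next hnext_closed hnext_large hnext_subset hnext_ediam hnext_disjoint using
    fun n (A : Level n) => A.2.2.exists_refinement hφ A.2.1 (hε n)
  let A : ∀ n, Level n := fun n => Nat.rec
    ⟨fun _ => univ, fun _ => isClosed_univ, isLargeFamily_univ_of_not_isSigmaInjOn h⟩
    (fun n A => ⟨next n A, hnext_closed n A, hnext_large n A⟩) n
  let S : List Bool → Set Z := fun l => (A l.length).1 ⟨l, rfl⟩
  have hSA : ∀ n (v : List.Vector Bool n), S v.1 = (A n).1 v := by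
    rintro _ ⟨l, rfl⟩
    rfl
  have hSdisj : ∀ l, Disjoint (S (false :: l)) (S (true :: l)) := fun l =>
    hnext_disjoint l.length (A l.length) ⟨l, rfl⟩
  refine ⟨S, fun l => (A l.length).2.1 _, fun l b => hnext_subset l.length _ b ⟨l, rfl⟩, ?_, ?_,
    fun n => ?_⟩
  · rintro l (_ | _) (_ | _) hne
    exacts [(hne rfl).elim, hSdisj l, (hSdisj l).symm, (hne rfl).elim]
  · intro x
    rw [← tendsto_add_atTop_iff_nat 1]
    refine tendsto_of_tendsto_of_tendsto_of_le_of_le tendsto_const_nhds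
      ENNReal.tendsto_inv_nat_nhds_zero (fun _ => zero_le) fun n => ?_
    exact (congrArg Metric.ediam (hSA (n + 1) ⟨PiNat.res x (n + 1), PiNat.res_length x _⟩)).trans_le
      (hnext_ediam n (A n) _)
  · simpa only [hSA] using (A n).2.2

theorem isSigmaInjOn_univ_of_continuous [TopologicalSpace Z] [PolishSpace Z] [BorelSpace Z]
    (hφ : Continuous φ) (hc : ∀ y, (φ ⁻¹' {y}).Countable) : IsSigmaInjOn φ univ := by
  let := upgradeIsCompletelyMetrizable Z
  by_contra h
  obtain ⟨S, hclosed, hanti, hdisj, hdiam, hlarge⟩ :=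
    exists_cantorScheme_isLargeFamily hφ.measurable h
  obtain ⟨f, hf, hconst⟩ := exists_injective_forall_map_eq hφ hclosed hanti hdisj hdiam
    fun l l' hl => by
      obtain ⟨y, hy⟩ := hlarge l.length ∅ (.of_injOn .empty (injOn_empty φ))
      simp only [sdiff_empty, mem_iInter] at hy
      exact ⟨y, hy ⟨l, rfl⟩, hy ⟨l', hl.symm⟩⟩
  have hcount : (univ : Set (ℕ → Bool)).Countable :=
    ((hc (φ (f fun _ => true))).preimage hf).mono fun x _ => hconst x _
  exact Cardinal.aleph0_lt_continuum.not_ge (by simpa using hcount.le_aleph0)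

end LusinNovikov

theorem isSigmaInjOn_univ_of_countable_fibers {Z Y : Type*} [MeasurableSpace Z]
    [StandardBorelSpace Z] [MeasurableSpace Y] [MeasurableSpace.CountablySeparated Y] {φ : Z → Y}
    (hφ : Measurable φ) (hc : ∀ y, (φ ⁻¹' {y}).Countable) : IsSigmaInjOn φ univ := by
  obtain ⟨e, he, hinj⟩ := MeasurableSpace.measurable_injection_nat_bool_of_countablySeparated Y
  have : IsCompletelyMetrizableSpace (ℕ → Bool) := .pi_countable
  obtain ⟨_, _, _, hcont⟩ := exists_polishSpace_borelSpace_continuous (he.comp hφ)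
  obtain ⟨B, hB, hBinj, hunion⟩ := isSigmaInjOn_univ_of_continuous hcont fun t => by
    rw [preimage_comp]
    rcases (subsingleton_singleton.preimage hinj).eq_empty_or_singleton with h | ⟨y, h⟩
    · rw [h, preimage_empty]
      exact countable_empty
    · rw [h]
      exact hc y
  exact ⟨B, hB, fun n => (hBinj n).of_comp, hunion⟩

section Disintegration

variable {X Y : Type*} [MeasurableSpace X] {κ : Y → Measure X}

theorem HasBorelCompactExhaustion.uniformlySigmaFinite [TopologicalSpace X] [T2Space X]
    [SecondCountableTopology X] [BorelSpace X] [MeasurableSpace Y] {φ : X → Y} (hφ : Measurable φ)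
    (hfiber : ∀ y, κ y (φ ⁻¹' {y})ᶜ = 0) (h : HasBorelCompactExhaustion κ) :
    UniformlySigmaFinite κ := by
  obtain ⟨K, hK, hfin, hnull⟩ := h
  have ae_mem_iff : ∀ y, ∀ᵐ x ∂κ y, ∀ n, x ∈ K n (φ x) ↔ x ∈ K n y := fun y => by
    filter_upwards [show ∀ᵐ x ∂κ y, φ x = y from hfiber y] with x hx n
    rw [hx]
  refine ⟨fun n => {x | x ∈ K n (φ x)}, fun n => ?_, fun n y => ?_, fun y => ?_⟩
  · exact (isClosed_setOf_mem_compacts X).measurableSet.preimage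
      (measurable_id.prodMk ((hK n).comp hφ))
  · refine lt_of_eq_of_lt (measure_congr ?_) (hfin y n)
    filter_upwards [ae_mem_iff y] with x hx using propext (hx n)
  · refine Eq.trans (measure_congr ?_) (hnull y)
    filter_upwards [ae_mem_iff y] with x hx
    exact propext (not_congr (by simp only [mem_iUnion, mem_ofPred_eq, SetLike.mem_coe, hx]))

theorem UniformlySigmaFinite.comp {W : Type*} (h : UniformlySigmaFinite κ) (g : W → Y) :
    UniformlySigmaFinite (κ ∘ g) := by
  obtain ⟨B, hB, hfin, hnull⟩ := h
  exact ⟨B, hB, fun n w => hfin n (g w), fun w => hnull (g w)⟩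

theorem UniformlySigmaFinite.measurable_measure_prodMk_left [MeasurableSpace Y]
    (h : UniformlySigmaFinite κ) (hκ : Measurable κ) {t : Set (Y × X)} (ht : MeasurableSet t) :
    Measurable fun y => κ y (Prod.mk y ⁻¹' t) := by
  obtain ⟨B, hB, hfin, hnull⟩ := h
  have hD : ∀ n, MeasurableSet (disjointed B n) := fun n => .disjointed hB n
  let η : ProbabilityTheory.Kernel Y X := ⟨κ, hκ⟩
  have η_restrict_finite : ∀ n y, IsFiniteMeasure (η.restrict (hD n) y) := fun n y => ⟨by
    rw [ProbabilityTheory.Kernel.restrict_apply, Measure.restrict_apply_univ]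
    exact (measure_mono (disjointed_subset B n)).trans_lt (hfin n y)⟩
  have eq_tsum : ∀ y, κ y (Prod.mk y ⁻¹' t) =
      ∑' n, η.restrict (hD n) y (Prod.mk y ⁻¹' t) := fun y => by
    have hty : MeasurableSet (Prod.mk y ⁻¹' t) := measurable_prodMk_left ht
    simp_rw [ProbabilityTheory.Kernel.restrict_apply, Measure.restrict_apply hty]
    rw [← measure_inter_conull (t := ⋃ n, B n) (by simpa using hnull y), ← iUnion_disjointed,
      inter_iUnion, measure_iUnion (fun i j hij => (disjoint_disjointed B hij).mono
        inter_subset_right inter_subset_right) fun n => hty.inter (hD n)]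
    rfl
  simp_rw [eq_tsum]
  exact .tsum fun n => ProbabilityTheory.Kernel.measurable_kernel_prodMk_left_of_finite ht
    (η_restrict_finite n)

theorem UniformlySigmaFinite.jointlyBorelOnCompacts [TopologicalSpace X] [T2Space X]
    [SecondCountableTopology X] [BorelSpace X] [TopologicalSpace Y] [MeasurableSpace Y]
    [BorelSpace Y] (hκ : Measurable κ) (h : UniformlySigmaFinite κ) :
    JointlyBorelOnCompacts κ := by
  rw [JointlyBorelOnCompacts, ← BorelSpace.measurable_eq (α := Y × Compacts X)]
  have ht : MeasurableSet {q : (Y × Compacts X) × X | q.2 ∈ q.1.2} :=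
    (isClosed_setOf_mem_compacts X).measurableSet.preimage
      (measurable_snd.prodMk (measurable_snd.comp measurable_fst))
  exact (h.comp Prod.fst).measurable_measure_prodMk_left (hκ.comp measurable_fst) ht

end Disintegration

section Atoms

variable {X : Type*} [TopologicalSpace X] [SecondCountableTopology X] [MeasurableSpace X]

theorem IsMeasureAtom.exists_singleton_pos [T1Space X] [OpensMeasurableSpace X] {m : Measure X}
    {A : Set X} (hA : IsMeasureAtom m A) : ∃ x ∈ A, 0 < m {x} := by
  obtain ⟨hAm, hpos, hsplit⟩ := hA
  have hb := isBasis_countableBasis X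
  have null_or_conull : ∀ U ∈ countableBasis X, m (A ∩ U) = 0 ∨ m (A \ U) = 0 := fun U hU => by
    simpa using hsplit (A ∩ U) inter_subset_left (hAm.inter (hb.isOpen hU).measurableSet)
  have biUnion_null : ∀ F : Set X → Set X,
      m (⋃ U ∈ {U ∈ countableBasis X | m (F U) = 0}, F U) = 0 := fun F =>
    (measure_biUnion_null_iff ((countable_countableBasis X).mono (sep_subset _ _))).2
      fun U hU => hU.2
  obtain ⟨x, hxA, hx⟩ : ∃ x ∈ A, ∀ U ∈ countableBasis X, x ∈ U → m (A \ U) = 0 := by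
    by_contra! hcon
    refine hpos.ne' (measure_mono_null (fun x hxA => ?_) (biUnion_null fun U => A ∩ U))
    obtain ⟨U, hU, hxU, hUpos⟩ := hcon x hxA
    exact mem_biUnion (x := U) ⟨hU, (null_or_conull U hU).resolve_right hUpos⟩ ⟨hxA, hxU⟩
  refine ⟨x, hxA, pos_iff_ne_zero.2 fun hx0 => hpos.ne' ?_⟩
  refine measure_mono_null (fun z hzA => ?_) (measure_union_null hx0 (biUnion_null fun U => A \ U))
  by_cases hzx : z = x
  · exact .inl hzx
  obtain ⟨U, hU, hxU, hUz⟩ := hb.exists_subset_of_mem_open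
    (show x ∈ ({z}ᶜ : Set X) from Ne.symm hzx) isOpen_compl_singleton
  exact .inr (mem_biUnion (x := U) ⟨hU, hx U hU hxU⟩ ⟨hzA, fun hzU => hUz hzU rfl⟩)

theorem IsPurelyAtomicMeasure.measure_eq_zero [T1Space X] [OpensMeasurableSpace X]
    {m : Measure X} (hm : IsPurelyAtomicMeasure m) {E : Set X} (hE : MeasurableSet E)
    (hnull : ∀ x ∈ E, m {x} = 0) : m E = 0 := by
  by_contra hpos
  obtain ⟨A, hAE, hA⟩ := hm E hE (pos_iff_ne_zero.2 hpos)
  obtain ⟨x, hxA, hx⟩ := hA.exists_singleton_pos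
  exact hx.ne' (hnull x (hAE hxA))

variable {Y : Type*} {φ : X → Y} {κ : Y → Measure X}

theorem measure_fiber_atoms_compl_eq_zero [T1Space X] [OpensMeasurableSpace X]
    (hfiber : ∀ y, κ y (φ ⁻¹' {y})ᶜ = 0)
    (hatomic : ∀ y, IsPurelyAtomicMeasure (κ y))
    (hA : MeasurableSet {x | 0 < κ (φ x) {x}}) (y : Y) : κ y {x | 0 < κ (φ x) {x}}ᶜ = 0 := by
  refine (hatomic y).measure_eq_zero hA.compl fun x hx => ?_
  by_cases hxy : φ x = y
  · simpa [hxy] using hx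
  · exact measure_mono_null (singleton_subset_iff.2 hxy) (hfiber y)

variable [BorelSpace X] [TopologicalSpace Y] [MeasurableSpace Y] [BorelSpace Y]

theorem JointlyBorelOnCompacts.measurable_measure_singleton (h : JointlyBorelOnCompacts κ)
    (hφ : Measurable φ) : Measurable fun x => κ (φ x) {x} := by
  rw [JointlyBorelOnCompacts, ← BorelSpace.measurable_eq (α := Y × Compacts X)] at h
  simpa only [Function.comp_def, Compacts.coe_singleton] using
    h.comp (hφ.prodMk (Compacts.continuous_singleton (α := X)).measurable)

theorem JointlyBorelOnCompacts.uniformlySigmaFinite [T1Space X] [StandardBorelSpace X]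
    [MeasurableSpace.CountablySeparated Y] (hφ : Measurable φ)
    (hfiber : ∀ y, κ y (φ ⁻¹' {y})ᶜ = 0) [∀ y, SigmaFinite (κ y)]
    (hatomic : ∀ y, IsPurelyAtomicMeasure (κ y)) (h : JointlyBorelOnCompacts κ) :
    UniformlySigmaFinite κ := by
  let A : Set X := {x | 0 < κ (φ x) {x}}
  have hA : MeasurableSet A :=
    measurableSet_lt measurable_const (h.measurable_measure_singleton hφ)
  have : StandardBorelSpace A := hA.standardBorel
  have countable_fibers : ∀ y, ((fun x : A => φ x) ⁻¹' {y}).Countable := fun y => by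
    have hc : {x | 0 < κ y {x}}.Countable :=
      Measure.countable_meas_pos_of_disjoint_iUnion (fun x => measurableSet_singleton x)
        fun x x' hne => disjoint_singleton.2 hne
    refine (hc.preimage Subtype.val_injective).mono ?_
    rintro x rfl
    exact x.2
  obtain ⟨B, hB, hinj, hunion⟩ :=
    isSigmaInjOn_univ_of_countable_fibers (hφ.comp measurable_subtype_coe) countable_fibers
  refine ⟨fun n => Subtype.val '' B n, fun n => hA.subtype_image (hB n), fun n y => ?_,
    fun y => ?_⟩
  · have hsub : (Subtype.val '' B n ∩ φ ⁻¹' {y}).Subsingleton := by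
      rintro _ ⟨⟨x, hx, rfl⟩, hxy⟩ _ ⟨⟨x', hx', rfl⟩, hxy'⟩
      exact congrArg _ (hinj n hx hx' (Eq.trans hxy (Eq.symm hxy')))
    rw [← measure_inter_conull (hfiber y)]
    exact hsub.induction_on (p := fun s => κ y s < ∞) (by simp) fun x => measure_singleton_lt_top
  · rw [← image_iUnion, hunion, image_univ, Subtype.range_coe]
    exact measure_fiber_atoms_compl_eq_zero hfiber hatomic hA y

end Atoms

theorem mainTheorem4_general {X Y : Type*} [TopologicalSpace X] [T2Space X]
    [SecondCountableTopology X] [MeasurableSpace X] [BorelSpace X] [StandardBorelSpace X]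
    [TopologicalSpace Y] [MeasurableSpace Y] [BorelSpace Y] [MeasurableSpace.CountablySeparated Y]
    {φ : X → Y} (hφ : Measurable φ) {κ : Y → Measure X} (hκ : Measurable κ)
    (hfiber : ∀ y, κ y (φ ⁻¹' {y})ᶜ = 0) :
    (UniformlySigmaFinite κ ↔ HasBorelCompactExhaustion κ) ∧
    (UniformlySigmaFinite κ → JointlyBorelOnCompacts κ) ∧
    (HasBorelCompactExhaustion κ → JointlyBorelOnCompacts κ) ∧
    ((∀ y, SigmaFinite (κ y)) → (∀ y, IsPurelyAtomicMeasure (κ y)) →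
      [UniformlySigmaFinite κ, HasBorelCompactExhaustion κ, JointlyBorelOnCompacts κ].TFAE) := by
  have exhaustion_iff : UniformlySigmaFinite κ ↔ HasBorelCompactExhaustion κ :=
    ⟨fun h => h.hasBorelCompactExhaustion hκ, fun h => h.uniformlySigmaFinite hφ hfiber⟩
  have jointlyBorel : UniformlySigmaFinite κ → JointlyBorelOnCompacts κ := fun h =>
    h.jointlyBorelOnCompacts hκ
  refine ⟨exhaustion_iff, jointlyBorel, jointlyBorel ∘ exhaustion_iff.2, fun _ hatomic => ?_⟩
  tfae_have 1 ↔ 2 := exhaustion_iff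
  tfae_have 1 → 3 := jointlyBorel
  tfae_have 3 → 1 := fun h => h.uniformlySigmaFinite hφ hfiber hatomic
  tfae_finish

theorem mainTheorem4 {X Y : Type*}
    [TopologicalSpace X] [PolishSpace X] [MeasurableSpace X] [BorelSpace X]
    [TopologicalSpace Y] [PolishSpace Y] [MeasurableSpace Y] [BorelSpace Y]
    (φ : X → Y) (hφ : Measurable φ) (μ : Measure X) (ν : Measure Y)
    (κ : Y → Measure X) (hκ : IsSigmaFiniteDisintegration κ μ ν φ) :
    (UniformlySigmaFinite κ ↔ HasBorelCompactExhaustion κ) ∧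
    (UniformlySigmaFinite κ → JointlyBorelOnCompacts κ) ∧
    (HasBorelCompactExhaustion κ → JointlyBorelOnCompacts κ) ∧
    ((∀ y, IsPurelyAtomicMeasure (κ y)) →
      [UniformlySigmaFinite κ, HasBorelCompactExhaustion κ, JointlyBorelOnCompacts κ].TFAE) := by
  have h := mainTheorem4_general hφ (Measure.measurable_measure.2 hκ.measurable_apply) hκ.fiber
  exact ⟨h.1, h.2.1, h.2.2.1, h.2.2.2 hκ.sigmaFinite⟩
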